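/- Let $\mathcal X$ be a set (the possible exact convolution outputs), $\mathcal Y$ a measurable space, and let $\mathcal R$ be a local randomizer, assigning to every $x\in\mathcal X$ the law $\mathcal R(x)$ of a random element of $\mathcal Y$. For laws $P,Q$ write $P\preceq_{\varepsilon,\delta}Q$ if $P(S)\le e^{\varepsilon}Q(S)+\delta$ for every measurable set $S$. The randomizer $\mathcal R$ is $(\varepsilon_0,\delta_0)$-locally differentially private (LDP) if $\mathcal R(x)\preceq_{\varepsilon_0,\delta_0}\mathcal R(x')$ for all $x,x'\in\mathcal X$. A randomized mechanism $\mathcal M$ on $\mathcal X^n$ is $(\varepsilon,\delta)$-differentially private (DP) if $\mathcal M(\mathbf x)\preceq_{\varepsilon,\delta}\mathcal M(\mathbf x')$ for all $\mathbf x,\mathbf x'\in\mathcal X^n$ that differ in at most one entry. In a round of Safhire with $n\ge 1$ exact convolution outputs $x_1,\dots,x_n\in\mathcal X$, the server forms independent noisy outputs $y_i\sim\mathcal R(x_i)$, draws a permutation $\sigma$ of $\{1,\dots,n\}$ uniformly at random and independently of them, and the client observes $(y_{\sigma(1)},\dots,y_{\sigma(n)})$. **Theorem.** Let $\varepsilon_0,\delta_0\ge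 0$ and suppose that $\mathcal R$ is $(\varepsilon_0,\delta_0)$-LDP. Then for every $\delta\in(0,1]$ with $\varepsilon_0\le\ln\left(\frac{n}{16\ln(2/\delta)}\right)$ there is an $\varepsilon$ with $$0\le\varepsilon\le\ln\left(1+\frac{e^{\varepsilon_0}-1}{e^{\varepsilon_0}+1}\left(\frac{8\sqrt{e^{\varepsilon_0}\ln(4/\delta)}}{\sqrt n}+\frac{8e^{\varepsilon_0}}{n}\right)\right)$$ such that the mechanism mapping $(x_1,\dots,x_n)$ to the client's observation $(y_{\sigma(1)},\dots,y_{\sigma(n)})$ is $$\left(\varepsilon,\ \delta+(e^{\varepsilon}+1)\left(\tfrac{e^{-\varepsilon_0}}{2}+1\right)n\,\delta_0\right)\text{-DP}.$$ -/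

import Mathlib

open MeasureTheory

noncomputable section

namespace Safhire

/-- `P` and `Q` satisfy the one-sided `(ε, δ)`-indistinguishability inequality
`P(S) ≤ e^ε Q(S) + δ` for every event `S`. -/
def DPBound {Z : Type*} [MeasurableSpace Z] (ε δ : ℝ) (P Q : Measure Z) : Prop :=
  ∀ S : Set Z, MeasurableSet S →
    P S ≤ ENNReal.ofReal (Real.exp ε) * Q S + ENNReal.ofReal δ

/-- The randomizer `R`, which maps an input `x` to the law `R x` of a random output, is
`(ε, δ)`-locally differentially private: the bound holds for all pairs of inputs. -/
def IsLocallyDP {X Y : Type*} [MeasurableSpace Y] (R : X → Measure Y) (ε δ : ℝ) : Prop :=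
  ∀ x x' : X, DPBound ε δ (R x) (R x')

/-- Two `n`-tuples are neighbouring if they differ in at most one entry. -/
def Neighbouring {X : Type*} {n : ℕ} (x x' : Fin n → X) : Prop :=
  ∃ i, ∀ j, j ≠ i → x j = x' j

/-- The mechanism `M`, which maps an `n`-tuple of inputs to the law of a random output, is
(centrally) `(ε, δ)`-differentially private. `Neighbouring` is symmetric, so both directions
of the inequality are required. -/
def IsDP {X Z : Type*} [MeasurableSpace Z] {n : ℕ}
    (M : (Fin n → X) → Measure Z) (ε δ : ℝ) : Prop :=
  ∀ x x' : Fin n → X, Neighbouring x x' → DPBound ε δ (M x) (M x')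

/-- The joint law of the `n` noisy convolution outputs of a round: the exact outputs
`x 0, …, x (n - 1)` are obfuscated one by one, independently, by the local randomizer `R`. -/
def convolutionOutputs {X Y : Type*} [MeasurableSpace Y] (R : X → Measure Y) {n : ℕ}
    (x : Fin n → X) : Measure (Fin n → Y) :=
  Measure.pi fun i => R (x i)

/-- The shuffler: the law of `(y (σ 0), …, y (σ (n - 1)))`, where `y` has law `μ` and `σ` is an
independent uniformly random permutation. -/
def shuffle {Y : Type*} [MeasurableSpace Y] {n : ℕ} (μ : Measure (Fin n → Y)) :
    Measure (Fin n → Y) :=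
  ∑ σ : Equiv.Perm (Fin n),
    ((n.factorial : ENNReal))⁻¹ • μ.map (fun y i => y (σ i))

/-- What the client observes in a round: the noisy convolution outputs, shuffled by the server
with a fresh uniformly random permutation. -/
def clientView {X Y : Type*} [MeasurableSpace Y] (R : X → Measure Y) {n : ℕ}
    (x : Fin n → X) : Measure (Fin n → Y) :=
  shuffle (convolutionOutputs R x)

end Safhire

end

/-!
Privacy amplification by cloning. Let the inputs differ at `i₀`, with laws `P` and `Q` there, and
let `e = exp ε₀`. If `δ₀ = 0`, then `P` and `Q` are randomized responses: mixtures of two laws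
`q₀`, `q₁` with weights `e / (e + 1)` and `1 / (e + 1)`, in either order. Every other law dominates
`e⁻¹ • P` and `e⁻¹ • Q`, hence also `(e⁻¹ / 2) • (P + Q) = (e⁻¹ / 2) • (q₀ + q₁)`: any other user
sends a clone of `q₀` or of `q₁`, with probability `e⁻¹ / 2` each.

The probability of an event after shuffling is a symmetric multilinear functional of the laws.
Splitting each law into the two clones and a remainder expands it into a sum of values `F κ` over
the colourings `κ` of the users by these three parts, and `F κ` does not change when the colours of
a `q₀`-user and a `q₁`-user are exchanged. Exchanging the colour of `i₀` with every possible partner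
gives `∑ #{q₁-users} * F κ = ∑ #{q₀-users} * F κ`, where `i₀` has colour `q₀` on the left and `q₁`
on the right. So `q₀` can be traded for `q₁` at `i₀` at the cost of a factor `1 + r` as long as
there are at most `1 + r` times as many `q₀`-users as `q₁`-users; a Chernoff bound controls the
remaining colourings.

For `δ₀ > 0`, each domination `μ ≤ ν` becomes `μ ⊓ ν ≤ ν`, at the cost of the mass of `μ` that
`μ ⊓ ν` misses.
-/

namespace Safhire

open Finset
open scoped NNReal

theorem exp_neg_le_quadratic {u : ℝ} (hu : 0 ≤ u) : Real.exp (-u) ≤ 1 - u + u ^ 2 / 2 := by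
  rw [Real.exp_neg]
  refine inv_le_of_inv_le₀ (by nlinarith [sq_nonneg (u - 1)]) ?_
  refine le_trans (inv_le_of_inv_le₀ (by positivity) ?_) (Real.quadratic_le_exp_of_nonneg hu)
  rw [inv_le_iff_one_le_mul₀ (by positivity)]
  nlinarith [sq_nonneg (u ^ 2)]

theorem exp_add_exp_neg_mul_le {r : ℝ} (hr₀ : 0 ≤ r) (hr₂ : r ≤ 2) :
    Real.exp (r / 11) + Real.exp (-((1 + r) * (r / 11))) ≤ 2 - r ^ 2 / 22 := by
  have hpos : Real.exp (r / 11) ≤ 1 + r / 11 + (r / 11) ^ 2 := by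
    have := le_of_abs_le (Real.abs_exp_sub_one_sub_id_le
      (x := r / 11) (by rw [abs_of_nonneg (by positivity)]; linarith))
    linarith
  have hneg := exp_neg_le_quadratic (u := (1 + r) * (r / 11)) (by positivity)
  have hsq : (1 + r) ^ 2 * r ^ 2 ≤ 9 * r ^ 2 := by
    gcongr
    nlinarith
  nlinarith

theorem mixture_le {A B a b r τ : ℝ} (hr : 0 ≤ r) (hτ : 0 ≤ τ) (hb : 0 ≤ b) (hba : b ≤ a)
    (hab : a + b = 1) (hA : 0 ≤ A) (hB : 0 ≤ B) (h : A ≤ (1 + r) * B + τ) :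
    a * A + b * B ≤ (1 + (a - b) * r) * (b * A + a * B) + τ := by
  have ha : 0 ≤ a := hb.trans hba
  have hdiff : A - B ≤ r * (b * A + a * B) + τ := by
    rcases le_total A B with hAB | hBA
    · have : 0 ≤ r * (b * A + a * B) + τ := by positivity
      linarith
    · have hB_le : B ≤ b * A + a * B :=
        calc B = b * B + a * B := by rw [← add_mul, add_comm b, hab, one_mul]
          _ ≤ b * A + a * B := by gcongr
      have := mul_le_mul_of_nonneg_left hB_le hr
      linarith
  calc a * A + b * B = b * A + a * B + (a - b) * (A - B) := by ring
    _ ≤ b * A + a * B + (a - b) * (r * (b * A + a * B) + τ) := by gcongr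
    _ = (1 + (a - b) * r) * (b * A + a * B) + (a - b) * τ := by ring
    _ ≤ (1 + (a - b) * r) * (b * A + a * B) + τ := by
        gcongr
        exact mul_le_of_le_one_left hτ (by linarith)

section Colouring

variable {ι α : Type*} [Fintype ι] [DecidableEq α]

theorem card_filter_comp_perm (κ : ι → α) (σ : Equiv.Perm ι) (p : α) :
    #{i | (κ ∘ σ) i = p} = #{i | κ i = p} :=
  card_equiv σ (by simp)

theorem exp_card_sub_card_eq_prod (κ : ι → α) (p q : α) (t s : ℝ) :
    Real.exp (t * (#{i | κ i = p} - s * #{i | κ i = q})) =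
      ∏ i, Real.exp (t * ((if κ i = p then 1 else 0) - s * (if κ i = q then 1 else 0))) := by
  rw [← Real.exp_sum, ← mul_sum, sum_sub_distrib, ← mul_sum, sum_boole, sum_boole]

variable [DecidableEq ι] [Fintype α]

theorem sum_mul_card_exchange {F : (ι → α) → ℝ} {p q : α}
    (hF : ∀ κ i j, κ i = p → κ j = q → F (κ ∘ Equiv.swap i j) = F κ) (i₀ : ι) :
    ∑ κ with κ i₀ = p, #{j | κ j = q} * F κ = ∑ κ with κ i₀ = q, #{j | κ j = p} * F κ := by
  have expand (p q : α) : ∑ κ with κ i₀ = p, #{j | κ j = q} * F κ =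
      ∑ j, ∑ κ with κ i₀ = p ∧ κ j = q, F κ := by
    simp only [← filter_filter, sum_filter _ F]
    rw [sum_comm]
    simp only [← sum_filter, sum_const, nsmul_eq_mul]
  rw [expand, expand]
  refine sum_congr rfl fun j _ => ?_
  refine sum_nbij' (· ∘ Equiv.swap i₀ j) (· ∘ Equiv.swap i₀ j) ?_ ?_ ?_ ?_ ?_
  · simp +contextual
  · simp +contextual
  · simp [Function.comp_assoc, ← Equiv.coe_trans]
  · simp [Function.comp_assoc, ← Equiv.coe_trans]
  · intro κ hκ
    obtain ⟨hp, hq⟩ := (mem_filter.mp hκ).2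
    exact (hF κ i₀ j hp hq).symm

theorem sum_filter_card_le {F : (ι → α) → ℝ} {p q : α} {s : ℝ} (hF₀ : 0 ≤ F)
    (hF : ∀ κ i j, κ i = p → κ j = q → F (κ ∘ Equiv.swap i j) = F κ) (hs : 0 ≤ s) (i₀ : ι) :
    ∑ κ with κ i₀ = p ∧ (#{j | κ j = p} : ℝ) ≤ s * #{j | κ j = q}, F κ
      ≤ s * ∑ κ with κ i₀ = q, F κ := by
  let G : (ι → α) → ℝ := fun κ =>
    if (#{j | κ j = p} : ℝ) ≤ s * #{j | κ j = q} then F κ / #{j | κ j = q} else 0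
  have hG : ∀ κ i j, κ i = p → κ j = q → G (κ ∘ Equiv.swap i j) = G κ := by
    intro κ i j hi hj
    simp only [G, card_filter_comp_perm, hF κ i j hi hj]
  have card_pos {κ : ι → α} {i : α} (hi : κ i₀ = i) : (0 : ℝ) < #{j | κ j = i} := by
    exact_mod_cast Finset.card_pos.mpr ⟨i₀, by simpa using hi⟩
  calc ∑ κ with κ i₀ = p ∧ (#{j | κ j = p} : ℝ) ≤ s * #{j | κ j = q}, F κ
      = ∑ κ with κ i₀ = p, #{j | κ j = q} * G κ := by
        rw [← filter_filter, sum_filter _ F]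
        refine sum_congr rfl fun κ hκ => ?_
        by_cases hle : (#{j | κ j = p} : ℝ) ≤ s * #{j | κ j = q}
        · have hq : (#{j | κ j = q} : ℝ) ≠ 0 := fun h => by
            rw [h, mul_zero] at hle
            exact hle.not_gt (card_pos (mem_filter.mp hκ).2)
          simp only [G, if_pos hle, mul_div_cancel₀ _ hq]
        · simp only [G, if_neg hle, mul_zero]
    _ = ∑ κ with κ i₀ = q, #{j | κ j = p} * G κ := sum_mul_card_exchange hG i₀
    _ ≤ ∑ κ with κ i₀ = q, s * F κ := by
        refine sum_le_sum fun κ hκ => ?_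
        by_cases hle : (#{j | κ j = p} : ℝ) ≤ s * #{j | κ j = q}
        · simp only [G, if_pos hle, ← mul_div_assoc]
          rw [div_le_iff₀ (card_pos (mem_filter.mp hκ).2), mul_right_comm]
          exact mul_le_mul_of_nonneg_right hle (hF₀ κ)
        · simp only [G, if_neg hle, mul_zero]
          exact mul_nonneg hs (hF₀ κ)
    _ = s * ∑ κ with κ i₀ = q, F κ := (mul_sum ..).symm

theorem filter_apply_eq_piFinset (i₀ : ι) (p : α) :
    ({κ | κ i₀ = p} : Finset (ι → α)) =
      Fintype.piFinset (Function.update (fun _ => univ) i₀ ({p} : Finset α)) := by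
  simpa using (Fintype.piFinset_update_singleton_eq_filter_piFinset_eq
    (fun _ : ι => univ) i₀ (mem_univ p)).symm

theorem sum_filter_eq_prod (h : ι → α → ℝ) (i₀ : ι) (p : α) :
    ∑ κ : ι → α with κ i₀ = p, ∏ i, h i (κ i) = h i₀ p * ∏ i ∈ univ.erase i₀, ∑ a, h i a := by
  rw [filter_apply_eq_piFinset, ← prod_univ_sum, ← mul_prod_erase _ _ (mem_univ i₀),
    Function.update_self, sum_singleton]
  congr 1
  exact prod_congr rfl fun i hi => by rw [Function.update_of_ne (ne_of_mem_erase hi)]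

theorem sum_filter_card_lt_le {w : ι → α → ℝ} (hw : ∀ i a, 0 ≤ w i a) (i₀ : ι) (p q : α)
    {t : ℝ} (ht : 0 ≤ t) (s : ℝ) :
    ∑ κ : ι → α with κ i₀ = p ∧ s * #{j | κ j = q} < (#{j | κ j = p} : ℝ), ∏ i, w i (κ i) ≤
      ∑ κ : ι → α with κ i₀ = p, ∏ i, w i (κ i) *
        Real.exp (t * ((if κ i = p then 1 else 0) - s * (if κ i = q then 1 else 0))) := by
  simp only [prod_mul_distrib, ← exp_card_sub_card_eq_prod]
  rw [← filter_filter]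
  have hnonneg (κ : ι → α) : 0 ≤ ∏ i, w i (κ i) := prod_nonneg fun i _ => hw i _
  refine (sum_le_sum fun κ hκ => ?_).trans
    (sum_le_sum_of_subset_of_nonneg (filter_subset ..) fun κ _ _ =>
      mul_nonneg (hnonneg κ) (Real.exp_pos _).le)
  exact le_mul_of_one_le_right (hnonneg κ)
    (Real.one_le_exp (mul_nonneg ht (sub_nonneg.mpr (mem_filter.mp hκ).2.le)))

theorem sum_clone_tail_le {w : ι → Fin 3 → ℝ} {c l r : ℝ} (hw : ∀ i a, 0 ≤ w i a)
    (hw₀ : ∀ i, w i 0 ≤ c / 2) (hw₁ : ∀ i, w i 1 ≤ c / 2) (hw₂ : ∀ i, w i 2 ≤ 1 - c)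
    (hr₀ : 0 ≤ r) (hr₂ : r ≤ 2) (hr : r ^ 2 * (c * Fintype.card ι) = 64 * l)
    (hl : Real.log 2 ≤ l) (i₀ : ι) :
    ∑ κ : ι → Fin 3 with κ i₀ = 0 ∧ (1 + r) * #{j | κ j = 1} < (#{j | κ j = 0} : ℝ),
      ∏ i, w i (κ i) ≤ c / 2 * Real.exp (-l) := by
  have hc₀ : 0 ≤ c := by linarith [hw i₀ 0, hw₀ i₀]
  have hc₁ : c ≤ 1 := by linarith [hw i₀ 2, hw₂ i₀]
  -- Exponential Markov at `r / 11` saves `c * r ^ 2 / 44` per coordinate, so `64 * l / 44` over all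
  -- of `ι`; the excess over `l` pays for the coordinate `i₀`, which is fixed.
  have factor_le (i : ι) : w i 0 * Real.exp (r / 11) + w i 1 * Real.exp (-((1 + r) * (r / 11)))
      + w i 2 ≤ Real.exp (-(c * r ^ 2 / 44)) := by
    have h₀ := mul_le_mul_of_nonneg_right (hw₀ i) (Real.exp_pos (r / 11)).le
    have h₁ := mul_le_mul_of_nonneg_right (hw₁ i) (Real.exp_pos (-((1 + r) * (r / 11)))).le
    have hexp := mul_le_mul_of_nonneg_left (exp_add_exp_neg_mul_le hr₀ hr₂)
      (by positivity : 0 ≤ c / 2)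
    linarith [hw₂ i, Real.one_sub_le_exp_neg (c * r ^ 2 / 44)]
  have factor_nonneg (i : ι) : 0 ≤ w i 0 * Real.exp (r / 11)
      + w i 1 * Real.exp (-((1 + r) * (r / 11))) + w i 2 :=
    add_nonneg (add_nonneg (mul_nonneg (hw i 0) (Real.exp_nonneg _))
      (mul_nonneg (hw i 1) (Real.exp_nonneg _))) (hw i 2)
  have hexponent : r / 11 + (Fintype.card ι - 1) * -(c * r ^ 2 / 44) ≤ -l := by
    have : c * r ^ 2 ≤ 4 := by nlinarith
    nlinarith [Real.log_two_gt_d9]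
  refine (sum_filter_card_lt_le hw i₀ 0 1 (t := r / 11) (by positivity) (1 + r)).trans ?_
  rw [sum_filter_eq_prod (fun i a => w i a *
    Real.exp (r / 11 * ((if a = 0 then 1 else 0) - (1 + r) * (if a = 1 then 1 else 0))))]
  calc _ = w i₀ 0 * Real.exp (r / 11) * ∏ i ∈ univ.erase i₀, (w i 0 * Real.exp (r / 11)
          + w i 1 * Real.exp (-((1 + r) * (r / 11))) + w i 2) := by
        simp [Fin.sum_univ_three, mul_comm (r / 11), -neg_add_rev]
    _ ≤ c / 2 * Real.exp (r / 11) * ∏ i ∈ univ.erase i₀, Real.exp (-(c * r ^ 2 / 44)) := by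
        gcongr with i
        exacts [prod_nonneg fun i _ => factor_nonneg i, hw₀ i₀, fun i _ => factor_nonneg i,
          factor_le i]
    _ = c / 2 * Real.exp (r / 11 + (Fintype.card ι - 1) * -(c * r ^ 2 / 44)) := by
        rw [prod_const, card_erase_of_mem (mem_univ i₀), card_univ, ← Real.exp_nat_mul,
          Nat.cast_pred (Fintype.card_pos_iff.mpr ⟨i₀⟩), mul_assoc, ← Real.exp_add]
    _ ≤ c / 2 * Real.exp (-l) := by gcongr

end Colouring

section Multilinear

variable {ι M : Type*} [DecidableEq ι] [AddCommMonoid M] [Module ℝ≥0 M]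
  (Φ : MultilinearMap ℝ≥0 (fun _ : ι => M) ℝ≥0)

theorem clone_comp_swap_eq (hΦ : ∀ ν (σ : Equiv.Perm ι), Φ (ν ∘ σ) = Φ ν) (x y : M) (z : ι → M)
    {κ : ι → Fin 3} {i j : ι} (hi : κ i = 0) (hj : κ j = 1) :
    Φ (fun k => ![x, y, z k] ((κ ∘ Equiv.swap i j) k)) = Φ (fun k => ![x, y, z k] (κ k)) := by
  rw [← hΦ (fun k => ![x, y, z k] (κ k)) (Equiv.swap i j)]
  congr 1
  ext1 k
  obtain rfl | hki := eq_or_ne k i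
  · simp [hj]
  obtain rfl | hkj := eq_or_ne k j
  · simp [hi]
  · simp [Equiv.swap_apply_of_ne_of_ne hki hkj]

variable [Fintype ι]

theorem map_update_sum_eq {α : Type*} [Fintype α] [DecidableEq α] (g : ι → α → M) (i₀ : ι) (p : α) :
    Φ (Function.update (fun i => ∑ a, g i a) i₀ (g i₀ p)) =
      ∑ κ : ι → α with κ i₀ = p, Φ fun i => g i (κ i) := by
  rw [filter_apply_eq_piFinset, ← Φ.map_sum_finset]
  congr 1
  ext1 i
  by_cases hi : i = i₀
  · subst hi; simp
  · simp [hi]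

theorem map_update_clone_le (hΦ : ∀ ν (σ : Equiv.Perm ι), Φ (ν ∘ σ) = Φ ν) {mass : M → ℝ≥0}
    (hmass : ∀ ν, Φ ν ≤ ∏ i, mass (ν i)) {x y : M} {z : ι → M} {c : ℝ≥0} {l r : ℝ}
    (hx : mass x ≤ c / 2) (hy : mass y ≤ c / 2) (hz : ∀ i, mass (z i) + c ≤ 1)
    (hr₀ : 0 ≤ r) (hr₂ : r ≤ 2) (hr : r ^ 2 * (c * Fintype.card ι) = 64 * l)
    (hl : Real.log 2 ≤ l) (i₀ : ι) :
    (Φ (Function.update (fun i => x + y + z i) i₀ x) : ℝ) ≤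
      (1 + r) * Φ (Function.update (fun i => x + y + z i) i₀ y) + c / 2 * Real.exp (-l) := by
  let T : (ι → Fin 3) → ℝ := fun κ => Φ fun i => ![x, y, z i] (κ i)
  have hx' := map_update_sum_eq Φ (fun i => ![x, y, z i]) i₀ 0
  have hy' := map_update_sum_eq Φ (fun i => ![x, y, z i]) i₀ 1
  simp only [Fin.sum_univ_three, Matrix.cons_val] at hx' hy'
  have hgood : ∑ κ with κ i₀ = 0 ∧ (#{j | κ j = 0} : ℝ) ≤ (1 + r) * #{j | κ j = 1}, T κ ≤
      (1 + r) * ∑ κ with κ i₀ = 1, T κ :=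
    sum_filter_card_le (fun κ => NNReal.coe_nonneg _)
      (fun κ i j hi hj => congrArg NNReal.toReal (clone_comp_swap_eq Φ hΦ x y z hi hj))
      (by positivity) i₀
  have hbad : ∑ κ with κ i₀ = 0 ∧ (1 + r) * #{j | κ j = 1} < (#{j | κ j = 0} : ℝ), T κ ≤
      c / 2 * Real.exp (-l) := by
    refine (sum_le_sum fun κ _ => ?_).trans (sum_clone_tail_le
      (w := fun i a => (mass (![x, y, z i] a) : ℝ)) (fun _ _ => NNReal.coe_nonneg _)
      (fun _ => by exact_mod_cast hx) (fun _ => by exact_mod_cast hy)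
      (fun i => le_sub_iff_add_le.mpr (by exact_mod_cast hz i)) hr₀ hr₂ hr hl i₀)
    exact_mod_cast hmass _
  rw [hx', hy', NNReal.coe_sum, NNReal.coe_sum]
  change ∑ κ with κ i₀ = 0, T κ ≤ (1 + r) * ∑ κ with κ i₀ = 1, T κ + _
  rw [← sum_filter_add_sum_filter_not _
    (fun κ : ι → Fin 3 => (#{j | κ j = 0} : ℝ) ≤ (1 + r) * #{j | κ j = 1}) T]
  simp only [filter_filter, not_le]
  exact add_le_add hgood hbad

theorem map_update_clone_mix_le (hΦ : ∀ ν (σ : Equiv.Perm ι), Φ (ν ∘ σ) = Φ ν) {mass : M → ℝ≥0}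
    (hmass : ∀ ν, Φ ν ≤ ∏ i, mass (ν i)) {q₀ q₁ : M} {z : ι → M} {a b c : ℝ≥0} {l r : ℝ}
    (hab : a + b = 1) (hba : b ≤ a) (hc : c ≠ 0) (hq₀ : mass ((c / 2) • q₀) ≤ c / 2)
    (hq₁ : mass ((c / 2) • q₁) ≤ c / 2) (hz : ∀ i, mass (z i) + c ≤ 1)
    (hr₀ : 0 ≤ r) (hr₂ : r ≤ 2) (hr : r ^ 2 * (c * Fintype.card ι) = 64 * l)
    (hl : Real.log 2 ≤ l) (i₀ : ι) :
    (Φ (Function.update (fun i => (c / 2) • q₀ + (c / 2) • q₁ + z i) i₀ (a • q₀ + b • q₁)) : ℝ) ≤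
      (1 + (a - b) * r) * Φ (Function.update (fun i => (c / 2) • q₀ + (c / 2) • q₁ + z i) i₀
        (b • q₀ + a • q₁)) + Real.exp (-l) := by
  have hpure := map_update_clone_le Φ hΦ hmass hq₀ hq₁ hz hr₀ hr₂ hr hl i₀
  simp only [Φ.map_update_add, Φ.map_update_smul, smul_eq_mul, NNReal.coe_add, NNReal.coe_mul,
    NNReal.coe_div, NNReal.coe_ofNat] at hpure ⊢
  have hc' : (0 : ℝ) < c / 2 := by positivity
  refine mixture_le hr₀ (Real.exp_nonneg _) b.coe_nonneg (by exact_mod_cast hba)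
    (by exact_mod_cast hab) (NNReal.coe_nonneg _) (NNReal.coe_nonneg _) ?_
  refine le_of_mul_le_mul_left (hpure.trans_eq ?_) hc'
  ring

end Multilinear

section FiniteMeasureOrder

variable {Y : Type*} [MeasurableSpace Y]

noncomputable instance : SemilatticeInf (FiniteMeasure Y) :=
  Subtype.semilatticeInf fun μ _ hμ _ => @isFiniteMeasure_of_le _ _ _ μ hμ inf_le_left

theorem le_iff_forall_apply_le {μ ν : FiniteMeasure Y} :
    μ ≤ ν ↔ ∀ S, MeasurableSet S → μ S ≤ ν S := by
  change (μ : Measure Y) ≤ ν ↔ _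
  simp only [Measure.le_iff, ← FiniteMeasure.ennreal_coeFn_eq_coeFn_toMeasure, ENNReal.coe_le_coe]

instance : CanonicallyOrderedAdd (FiniteMeasure Y) where
  exists_add_of_le {μ ν} h := by
    have : IsFiniteMeasure ((ν : Measure Y) - (μ : Measure Y)) :=
      isFiniteMeasure_of_le ν Measure.sub_le
    refine ⟨⟨(ν : Measure Y) - (μ : Measure Y), this⟩, FiniteMeasure.toMeasure_injective ?_⟩
    exact ((add_comm _ _).trans (Measure.sub_add_cancel_of_le (ν := (μ : Measure Y)) h)).symm
  le_add_self μ ν := Measure.le_add_left (μ := (μ : Measure Y)) le_rfl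
  le_self_add μ ν := Measure.le_add_right (μ := (μ : Measure Y)) le_rfl

instance : IsOrderedAddMonoid (FiniteMeasure Y) where
  add_le_add_left _ _ h ρ := add_le_add_left (α := Measure Y) h ρ

instance : IsOrderedModule ℝ≥0 (FiniteMeasure Y) where
  smul_le_smul_of_nonneg_left c _ μ ν h := by
    simp only [le_iff_forall_apply_le, FiniteMeasure.smul_apply] at h ⊢
    exact fun S hS => smul_le_smul_of_nonneg_left (h S hS) zero_le
  smul_le_smul_of_nonneg_right μ _ c d h := by
    simp only [le_iff_forall_apply_le, FiniteMeasure.smul_apply]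
    exact fun S _ => smul_le_smul_of_nonneg_right h zero_le

theorem mass_add (μ ν : FiniteMeasure Y) : (μ + ν).mass = μ.mass + ν.mass := by
  simp [FiniteMeasure.mass, FiniteMeasure.coeFn_add]

theorem mass_smul (c : ℝ≥0) (μ : FiniteMeasure Y) : (c • μ).mass = c * μ.mass := by
  simp [FiniteMeasure.mass]

theorem mass_mono {μ ν : FiniteMeasure Y} (h : μ ≤ ν) : μ.mass ≤ ν.mass :=
  le_iff_forall_apply_le.mp h _ .univ

theorem exists_between_of_mass {μ ν : FiniteMeasure Y} (h : μ ≤ ν) {m : ℝ≥0} (hμ : μ.mass ≤ m)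
    (hν : m ≤ ν.mass) : ∃ ρ, μ ≤ ρ ∧ ρ ≤ ν ∧ ρ.mass = m := by
  obtain ⟨κ, rfl⟩ := exists_add_of_le h
  obtain ⟨t, rfl⟩ := exists_add_of_le hμ
  rw [mass_add, add_le_add_iff_left] at hν
  refine ⟨μ + (t / κ.mass) • κ, le_self_add, ?_, ?_⟩
  · gcongr
    exact smul_le_of_le_one_left zero_le (div_le_one_of_le₀ hν zero_le)
  · rw [mass_add, mass_smul, div_mul_cancel_of_imp]
    intro hκ
    exact le_zero_iff.mp (hκ ▸ hν)

end FiniteMeasureOrder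

section AlmostLE

variable {Y : Type*} [MeasurableSpace Y]

/-- `μ` exceeds `ν` by at most `δ` on every event. The `(ε, δ)`-indistinguishability inequality
for laws `P` and `Q` is `AlmostLE δ P (e • Q)` with `e` the exponential of `ε`. -/
def AlmostLE (δ : ℝ≥0) (μ ν : FiniteMeasure Y) : Prop :=
  ∀ S, MeasurableSet S → μ S ≤ ν S + δ

theorem almostLE_of_mass_le {δ : ℝ≥0} {μ ν ρ : FiniteMeasure Y} (hμ : ρ ≤ μ) (hν : ρ ≤ ν)
    (hmass : μ.mass ≤ ρ.mass + δ) : AlmostLE δ μ ν := by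
  obtain ⟨κ, rfl⟩ := exists_add_of_le hμ
  rw [mass_add, add_le_add_iff_left] at hmass
  intro S hS
  rw [FiniteMeasure.coeFn_add, Pi.add_apply]
  exact add_le_add (le_iff_forall_apply_le.mp hν S hS) ((κ.apply_le_mass S).trans hmass)

theorem AlmostLE.mass_le_mass_inf_add {δ : ℝ≥0} {μ ν : FiniteMeasure Y} (h : AlmostLE δ μ ν) :
    μ.mass ≤ (μ ⊓ ν).mass + δ := by
  rw [← ENNReal.coe_le_coe, ENNReal.coe_add, FiniteMeasure.ennreal_mass, FiniteMeasure.ennreal_mass]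
  change _ ≤ ((μ : Measure Y) ⊓ ν) Set.univ + δ
  rw [Measure.inf_apply .univ, ← tsub_le_iff_right]
  refine le_sInf ?_
  rintro _ ⟨t, rfl⟩
  simp only [Set.inter_univ, tsub_le_iff_right]
  set u := toMeasurable (ν : Measure Y) tᶜ
  have hu : MeasurableSet u := measurableSet_toMeasurable _ _
  have hut : uᶜ ⊆ t := Set.compl_subset_comm.mp (subset_toMeasurable _ _)
  have hle : (μ : Measure Y) u ≤ (ν : Measure Y) u + δ := by
    simp only [← FiniteMeasure.ennreal_coeFn_eq_coeFn_toMeasure]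
    exact_mod_cast h u hu
  calc (μ : Measure Y) Set.univ = (μ : Measure Y) uᶜ + (μ : Measure Y) u := by
        rw [add_comm, measure_add_measure_compl hu]
    _ ≤ (μ : Measure Y) t + ((ν : Measure Y) u + δ) := add_le_add (measure_mono hut) hle
    _ = (μ : Measure Y) t + (ν : Measure Y) tᶜ + δ := by rw [measure_toMeasurable, add_assoc]

theorem almostLE_of_le {μ ν : FiniteMeasure Y} (h : μ ≤ ν) (δ : ℝ≥0) : AlmostLE δ μ ν :=
  almostLE_of_mass_le le_rfl h le_self_add

theorem AlmostLE.mono_left {δ : ℝ≥0} {μ ν ρ : FiniteMeasure Y} (hμ : μ ≤ ν) (h : AlmostLE δ ν ρ) :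
    AlmostLE δ μ ρ :=
  fun S hS => (le_iff_forall_apply_le.mp hμ S hS).trans (h S hS)

theorem AlmostLE.mono {δ δ' : ℝ≥0} {μ ν : FiniteMeasure Y} (h : AlmostLE δ μ ν) (hδ : δ ≤ δ') :
    AlmostLE δ' μ ν :=
  fun S hS => (h S hS).trans (by gcongr)

theorem AlmostLE.add {δ δ' : ℝ≥0} {μ ν μ' ν' : FiniteMeasure Y} (h : AlmostLE δ μ ν)
    (h' : AlmostLE δ' μ' ν') : AlmostLE (δ + δ') (μ + μ') (ν + ν') := fun S hS => by
  rw [FiniteMeasure.coeFn_add, FiniteMeasure.coeFn_add, Pi.add_apply, Pi.add_apply,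
    add_add_add_comm]
  exact add_le_add (h S hS) (h' S hS)

theorem AlmostLE.smul {δ : ℝ≥0} {μ ν : FiniteMeasure Y} (h : AlmostLE δ μ ν) (c : ℝ≥0) :
    AlmostLE (c * δ) (c • μ) (c • ν) := fun S hS => by
  rw [FiniteMeasure.smul_apply, FiniteMeasure.smul_apply, smul_eq_mul, smul_eq_mul, ← mul_add]
  gcongr
  exact h S hS

end AlmostLE

section RandomizedResponse

variable {Y : Type*} [MeasurableSpace Y]

theorem inf_smul_le_smul_inf {e : ℝ≥0} (he : 1 ≤ e) (μ ν : FiniteMeasure Y) :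
    μ ⊓ e • ν ≤ e • (ν ⊓ e • μ) := by
  have he₀ : 0 < e := zero_lt_one.trans_le he
  rw [← inv_smul_le_iff_of_pos he₀]
  refine le_inf ((inv_smul_le_iff_of_pos he₀).mpr inf_le_right) ?_
  calc e⁻¹ • (μ ⊓ e • ν) ≤ e⁻¹ • μ := by gcongr; exact inf_le_left
    _ ≤ e • μ := by gcongr; exact (inv_le_one_of_one_le₀ he).trans he

theorem exists_le_mass_eq_of_le_smul {e : ℝ≥0} (he : 1 ≤ e) {μ ν : FiniteMeasure Y}
    (hμν : μ ≤ e • ν) (hνμ : ν ≤ e • μ) {m : ℝ≥0} (hm : m = min μ.mass ν.mass) :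
    ∃ μ' ν', μ' ≤ μ ∧ ν' ≤ ν ∧ μ'.mass = m ∧ ν'.mass = m ∧ μ' ≤ e • ν' ∧ ν' ≤ e • μ' := by
  wlog h : μ.mass ≤ ν.mass generalizing μ ν
  · obtain ⟨ν', μ', hν, hμ, hνm, hμm, hνμ', hμν'⟩ :=
      this hνμ hμν (hm.trans (min_comm ..)) (le_of_not_ge h)
    exact ⟨μ', ν', hμ, hν, hμm, hνm, hμν', hνμ'⟩
  rw [min_eq_left h] at hm
  have he₀ : 0 < e := zero_lt_one.trans_le he
  obtain ⟨ν', hμν', hν', hmass⟩ := exists_between_of_mass ((inv_smul_le_iff_of_pos he₀).mpr hμν)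
    (by rw [mass_smul]; exact mul_le_of_le_one_left zero_le (inv_le_one_of_one_le₀ he)) h
  exact ⟨μ, ν', le_rfl, hν', hm.symm, hmass.trans hm.symm, (inv_smul_le_iff_of_pos he₀).mp hμν',
    hν'.trans hνμ⟩

theorem exists_eq_mix_of_le_smul {e : ℝ≥0} (he : 1 ≤ e) {μ ν : FiniteMeasure Y}
    (hμν : μ ≤ e • ν) (hνμ : ν ≤ e • μ) (hmass : μ.mass = ν.mass) :
    ∃ q₀ q₁ : FiniteMeasure Y, q₀.mass = μ.mass ∧ q₁.mass = μ.mass ∧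
      μ = (e / (e + 1)) • q₀ + (1 / (e + 1)) • q₁ ∧
      ν = (1 / (e + 1)) • q₀ + (e / (e + 1)) • q₁ := by
  obtain rfl | he := he.eq_or_lt
  · obtain rfl : μ = ν := le_antisymm (by simpa using hμν) (by simpa using hνμ)
    refine ⟨μ, μ, rfl, rfl, ?_, ?_⟩ <;> rw [← add_smul] <;> norm_num
  obtain ⟨ρ, hρ⟩ := exists_add_of_le hμν
  obtain ⟨σ, hσ⟩ := exists_add_of_le hνμ
  have apply_eq {α β γ : FiniteMeasure Y} (h : e • α = β + γ) (S : Set Y) :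
      (γ S : ℝ) = e * α S - β S := by
    have := congrArg (fun κ : FiniteMeasure Y => (κ S : ℝ)) h
    simp only [FiniteMeasure.smul_apply, FiniteMeasure.coeFn_add, Pi.add_apply, smul_eq_mul,
      NNReal.coe_add, NNReal.coe_mul] at this
    linarith
  have mass_eq {α β γ : FiniteMeasure Y} (h : e • α = β + γ) (hβ : β.mass = α.mass) :
      ((e - 1)⁻¹ • γ).mass = α.mass := by
    have hmul := congrArg FiniteMeasure.mass h
    rw [mass_smul, mass_add, hβ] at hmul
    rw [mass_smul, inv_mul_eq_iff_eq_mul₀ (tsub_pos_of_lt he).ne', tsub_mul, one_mul, hmul,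
      add_tsub_cancel_left]
  have he' : (e - 1 : ℝ) ≠ 0 := sub_ne_zero.mpr (by exact_mod_cast he.ne')
  refine ⟨(e - 1)⁻¹ • σ, (e - 1)⁻¹ • ρ, mass_eq hσ hmass.symm, (mass_eq hρ hmass).trans hmass.symm,
    ?_, ?_⟩
  all_goals
    refine FiniteMeasure.eq_of_forall_apply_eq _ _ fun S _ => NNReal.eq ?_
    simp only [FiniteMeasure.smul_apply, FiniteMeasure.coeFn_add, Pi.add_apply, smul_eq_mul,
      NNReal.coe_add, NNReal.coe_mul, NNReal.coe_div, NNReal.coe_inv, NNReal.coe_sub he.le,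
      NNReal.coe_one, apply_eq hρ, apply_eq hσ]
    field_simp
    ring

theorem mass_smul_le {q : FiniteMeasure Y} (hq : q.mass ≤ 1) (c : ℝ≥0) : (c • q).mass ≤ c := by
  rw [mass_smul]
  exact mul_le_of_le_one_right' hq

theorem mass_mix_le {q₀ q₁ : FiniteMeasure Y} (h₀ : q₀.mass ≤ 1) (h₁ : q₁.mass ≤ 1) (a b : ℝ≥0) :
    (a • q₀ + b • q₁).mass ≤ a + b := by
  rw [mass_add]
  exact add_le_add (mass_smul_le h₀ a) (mass_smul_le h₁ b)

theorem AlmostLE.exists_randomizedResponse {δ e : ℝ≥0} (he : 1 ≤ e) {P Q : FiniteMeasure Y}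
    (hP : P.mass = 1) (hQ : Q.mass = 1) (hPQ : AlmostLE δ P (e • Q))
    (hQP : AlmostLE δ Q (e • P)) :
    ∃ q₀ q₁ : FiniteMeasure Y, q₀.mass = q₁.mass ∧ q₁.mass ≤ 1 ∧ 1 ≤ q₁.mass + δ ∧
      (e / (e + 1)) • q₀ + (1 / (e + 1)) • q₁ ≤ P ∧
      (1 / (e + 1)) • q₀ + (e / (e + 1)) • q₁ ≤ Q := by
  obtain ⟨P', Q', hP', hQ', hPm, hQm, hPQ', hQP'⟩ := exists_le_mass_eq_of_le_smul he
    (inf_smul_le_smul_inf he P Q) (inf_smul_le_smul_inf he Q P) rfl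
  obtain ⟨q₀, q₁, h₀, h₁, hPmix, hQmix⟩ :=
    exists_eq_mix_of_le_smul he hPQ' hQP' (hPm.trans hQm.symm)
  refine ⟨q₀, q₁, h₀.trans h₁.symm, ?_, ?_, hPmix.symm.trans_le (hP'.trans inf_le_left),
    hQmix.symm.trans_le (hQ'.trans inf_le_left)⟩
  · exact h₁.trans_le ((mass_mono (hP'.trans inf_le_left)).trans hP.le)
  · rw [h₁, hPm, ← min_add_add_right]
    exact le_min (hP ▸ hPQ.mass_le_mass_inf_add) (hQ ▸ hQP.mass_le_mass_inf_add)

theorem AlmostLE.exists_remainder {W R : FiniteMeasure Y} {c m η : ℝ≥0} (h : AlmostLE η W R)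
    (hW : W.mass ≤ c) (hW' : c ≤ W.mass + η) (hR : R.mass = c + m) :
    ∃ L : FiniteMeasure Y, L.mass = m ∧ AlmostLE η (W + L) R ∧ AlmostLE (2 * η) R (W + L) := by
  have hinf := h.mass_le_mass_inf_add
  obtain ⟨ρ, hρ⟩ := exists_add_of_le (inf_le_right : W ⊓ R ≤ R)
  have hmass := congrArg FiniteMeasure.mass hρ
  rw [mass_add, hR] at hmass
  have hmρ : m ≤ ρ.mass := by
    refine le_of_add_le_add_left (hmass.trans_le ?_)
    gcongr
    exact (mass_mono inf_le_left).trans hW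
  obtain ⟨L, -, hLρ, hL⟩ := exists_between_of_mass (zero_le (a := ρ)) (m := m) (by simp) hmρ
  have hWL : W ⊓ R + L ≤ W + L := by gcongr; exact inf_le_left
  have hRL : W ⊓ R + L ≤ R := (by gcongr : _ ≤ W ⊓ R + ρ).trans hρ.ge
  refine ⟨L, hL, almostLE_of_mass_le hWL hRL ?_, almostLE_of_mass_le hRL hWL ?_⟩
  · rw [mass_add, mass_add]
    linarith
  · rw [mass_add, hR, hL]
    linarith

theorem AlmostLE.clones {δ e : ℝ≥0} (he : e ≠ 0) {P Q R q₀ q₁ : FiniteMeasure Y}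
    (hP : AlmostLE δ P (e • R)) (hQ : AlmostLE δ Q (e • R)) (hq : q₀ + q₁ ≤ P + Q) :
    AlmostLE (e⁻¹ * δ) ((e⁻¹ / 2) • q₀ + (e⁻¹ / 2) • q₁) R := by
  have h := ((hP.add hQ).mono_left hq).smul (e⁻¹ / 2)
  have hδ : e⁻¹ / 2 * (δ + δ) = e⁻¹ * δ := by ring
  have hR : (e⁻¹ / 2) • (e • R + e • R) = R := by
    rw [← add_smul, smul_smul, ← two_mul, div_mul_eq_mul_div, mul_left_comm, inv_mul_cancel₀ he,
      mul_one, div_self two_ne_zero, one_smul]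
  rwa [hδ, hR, smul_add] at h

theorem exists_clone_decomposition {ι : Type*} {δ e : ℝ≥0} (he : 1 ≤ e) {P Q : FiniteMeasure Y}
    {ν : ι → FiniteMeasure Y} (hP : P.mass = 1) (hQ : Q.mass = 1) (hν : ∀ i, (ν i).mass = 1)
    (hPQ : AlmostLE δ P (e • Q)) (hQP : AlmostLE δ Q (e • P))
    (hPν : ∀ i, AlmostLE δ P (e • ν i)) (hQν : ∀ i, AlmostLE δ Q (e • ν i)) :
    ∃ (q₀ q₁ : FiniteMeasure Y) (L : ι → FiniteMeasure Y), q₀.mass ≤ 1 ∧ q₁.mass ≤ 1 ∧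
      (∀ i, (L i).mass + e⁻¹ = 1) ∧
      AlmostLE δ P ((e / (e + 1)) • q₀ + (1 / (e + 1)) • q₁) ∧
      (1 / (e + 1)) • q₀ + (e / (e + 1)) • q₁ ≤ Q ∧
      ∀ i, AlmostLE (e⁻¹ * δ) ((e⁻¹ / 2) • q₀ + (e⁻¹ / 2) • q₁ + L i) (ν i) ∧
        AlmostLE (2 * (e⁻¹ * δ)) (ν i) ((e⁻¹ / 2) • q₀ + (e⁻¹ / 2) • q₁ + L i) := by
  obtain ⟨q₀, q₁, hmass, hmass₁, hδ, hqP, hqQ⟩ := hPQ.exists_randomizedResponse he hP hQ hQP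
  have hab : e / (e + 1) + 1 / (e + 1) = 1 := by rw [← add_div, div_self (by positivity)]
  have he₀ : e ≠ 0 := (zero_lt_one.trans_le he).ne'
  have hsum : q₀ + q₁ ≤ P + Q := by
    refine le_trans (le_of_eq ?_) (add_le_add hqP hqQ)
    rw [add_add_add_comm, ← add_smul, ← add_smul, add_comm (1 / _), hab, one_smul, one_smul]
  have hWmass : ((e⁻¹ / 2) • q₀ + (e⁻¹ / 2) • q₁).mass = e⁻¹ * q₁.mass := by
    rw [mass_add, mass_smul, mass_smul, hmass]
    ring
  have hrem (i : ι) := ((hPν i).clones he₀ (hQν i) hsum).exists_remainder (c := e⁻¹)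
    (hWmass.trans_le (mul_le_of_le_one_right' hmass₁))
    (by rw [hWmass, ← mul_add]; exact le_mul_of_one_le_right zero_le hδ)
    ((hν i).trans (add_tsub_cancel_of_le (inv_le_one_of_one_le₀ he)).symm)
  choose L hL hWν hνW using hrem
  refine ⟨q₀, q₁, L, hmass.trans_le hmass₁, hmass₁, fun i => ?_, ?_, hqQ,
    fun i => ⟨hWν i, hνW i⟩⟩
  · rw [hL, tsub_add_cancel_of_le (inv_le_one_of_one_le₀ he)]
  · refine almostLE_of_mass_le hqP le_rfl ?_
    rw [hP, mass_add, mass_smul, mass_smul, hmass, ← add_mul, hab, one_mul]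
    exact hδ

end RandomizedResponse

section Perturbation

variable {ι Y : Type*} [MeasurableSpace Y]
  {Φ : MultilinearMap ℝ≥0 (fun _ : ι => FiniteMeasure Y) ℝ≥0}

theorem map_update_mono [DecidableEq ι] (ν : ι → FiniteMeasure Y) (i : ι) :
    Monotone fun μ => Φ (Function.update ν i μ) := by
  intro μ μ' h
  obtain ⟨κ, rfl⟩ := exists_add_of_le h
  simp only [Φ.map_update_add, le_add_iff_nonneg_right, zero_le]

variable [Fintype ι]

theorem map_update_le_add [DecidableEq ι] (hΦ : ∀ ν, Φ ν ≤ ∏ i, (ν i).mass)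
    {ν : ι → FiniteMeasure Y} {i : ι} (hν : ∀ j ≠ i, (ν j).mass ≤ 1) {η : ℝ≥0}
    {μ : FiniteMeasure Y} (h : AlmostLE η μ (ν i)) :
    Φ (Function.update ν i μ) ≤ Φ ν + η := by
  obtain ⟨D, hD⟩ := exists_add_of_le (inf_le_left : μ ⊓ ν i ≤ μ)
  have hDη : D.mass ≤ η := by
    have := h.mass_le_mass_inf_add
    nth_rw 1 [hD] at this
    rwa [mass_add, add_le_add_iff_left] at this
  rw [hD, Φ.map_update_add]
  gcongr
  · simpa using map_update_mono (Φ := Φ) ν i (inf_le_right : μ ⊓ ν i ≤ ν i)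
  · refine (hΦ _).trans ?_
    rw [← mul_prod_erase univ _ (mem_univ i), Function.update_self]
    refine (mul_le_of_le_one_right' (prod_le_one' fun j hj => ?_)).trans hDη
    rw [Function.update_of_ne (ne_of_mem_erase hj)]
    exact hν j (ne_of_mem_erase hj)

theorem map_le_map_add_sum (hΦ : ∀ ν, Φ ν ≤ ∏ i, (ν i).mass) {ν ν' : ι → FiniteMeasure Y}
    {η : ι → ℝ≥0} (hν : ∀ i, (ν i).mass ≤ 1) (hν' : ∀ i, (ν' i).mass ≤ 1)
    (h : ∀ i, AlmostLE (η i) (ν i) (ν' i)) : Φ ν ≤ Φ ν' + ∑ i, η i := by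
  classical
  suffices H : ∀ t : Finset ι, Φ (t.piecewise ν ν') ≤ Φ ν' + ∑ i ∈ t, η i by
    simpa using H univ
  intro t
  induction t using Finset.induction_on with
  | empty => simp
  | insert i t hi ih =>
    have hmass (j : ι) : (t.piecewise ν ν' j).mass ≤ 1 :=
      t.piecewise_cases ν ν' (fun μ : FiniteMeasure Y => μ.mass ≤ 1) (hν j) (hν' j)
    rw [piecewise_insert, sum_insert hi, add_comm (η i), ← add_assoc]
    refine (map_update_le_add hΦ (fun j _ => hmass j) (η := η i) ?_).trans (by gcongr)
    rw [piecewise_eq_of_notMem _ _ _ hi]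
    exact h i

end Perturbation

section Amplification

variable {ι Y : Type*} [Fintype ι] [DecidableEq ι] [MeasurableSpace Y]
  {Φ : MultilinearMap ℝ≥0 (fun _ : ι => FiniteMeasure Y) ℝ≥0}

theorem map_update_le_map_update_add (hΦ : ∀ ν, Φ ν ≤ ∏ i, (ν i).mass)
    {ν ν' : ι → FiniteMeasure Y} {μ μ' : FiniteMeasure Y} {η : ℝ≥0} (hν : ∀ i, (ν i).mass ≤ 1)
    (hν' : ∀ i, (ν' i).mass ≤ 1) (hμ : μ.mass ≤ 1) (hμ' : μ'.mass ≤ 1)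
    (h : ∀ i, AlmostLE η (ν i) (ν' i)) {i₀ : ι} (h₀ : AlmostLE η μ μ') :
    Φ (Function.update ν i₀ μ) ≤ Φ (Function.update ν' i₀ μ') + Fintype.card ι * η := by
  have hsum : ∑ _i : ι, η = Fintype.card ι * η := by rw [sum_const, card_univ, nsmul_eq_mul]
  rw [← hsum]
  refine map_le_map_add_sum hΦ
    ((Function.forall_update_iff ν fun _ κ => κ.mass ≤ 1).mpr ⟨hμ, fun i _ => hν i⟩)
    ((Function.forall_update_iff ν' fun _ κ => κ.mass ≤ 1).mpr ⟨hμ', fun i _ => hν' i⟩)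
    fun i => ?_
  obtain rfl | hi := eq_or_ne i i₀
  · simpa only [Function.update_self] using h₀
  · simpa only [Function.update_of_ne hi] using h i

theorem le_of_perturbed_amplification {A A' B' B E c t τ : ℝ} (hc : c ≤ 1) (hE : 1 ≤ E)
    (ht : 0 ≤ t) (hA : A ≤ A' + (1 + c) * t) (hAB : A' ≤ E * B' + τ) (hB : B' ≤ B + c * t) :
    A ≤ E * B + τ + (E + 1) * (c / 2 + 1) * t := by
  have hcost : 1 + c + E * c ≤ (E + 1) * (c / 2 + 1) := by nlinarith
  calc A ≤ E * (B + c * t) + τ + (1 + c) * t := by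
        refine hA.trans (add_le_add_left (hAB.trans ?_) _)
        gcongr
    _ = E * B + τ + (1 + c + E * c) * t := by ring
    _ ≤ E * B + τ + (E + 1) * (c / 2 + 1) * t := by gcongr

theorem map_le_mul_map_update_add (hΦ : ∀ ν (σ : Equiv.Perm ι), Φ (ν ∘ σ) = Φ ν)
    (hmass : ∀ ν, Φ ν ≤ ∏ i, (ν i).mass) {δ e : ℝ≥0} (he : 1 ≤ e) {ν : ι → FiniteMeasure Y}
    {Q : FiniteMeasure Y} (hν : ∀ i, (ν i).mass = 1) (hQ : Q.mass = 1) {i₀ : ι}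
    (hνQ : AlmostLE δ (ν i₀) (e • Q)) (hνν : ∀ j, AlmostLE δ (ν i₀) (e • ν j))
    (hQν : ∀ j, AlmostLE δ Q (e • ν j)) {l r : ℝ} (hr₀ : 0 ≤ r) (hr₂ : r ≤ 2)
    (hr : r ^ 2 * (Fintype.card ι / e) = 64 * l) (hl : Real.log 2 ≤ l) :
    (Φ ν : ℝ) ≤ (1 + (e - 1) / (e + 1) * r) * Φ (Function.update ν i₀ Q) + Real.exp (-l) +
      ((1 + (e - 1) / (e + 1) * r) + 1) * ((e : ℝ)⁻¹ / 2 + 1) * (Fintype.card ι * δ) := by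
  obtain ⟨q₀, q₁, L, hq₀, hq₁, hL, hP, hQ', hW⟩ :=
    exists_clone_decomposition he (hν i₀) hQ hν hνQ (hQν i₀) hνν hQν
  have he₀ : e ≠ 0 := (zero_lt_one.trans_le he).ne'
  have he₁ : e⁻¹ ≤ 1 := inv_le_one_of_one_le₀ he
  have hab : e / (e + 1) + 1 / (e + 1) = 1 := by rw [← add_div, div_self (by positivity)]
  have hab_sub : ((e / (e + 1) : ℝ≥0) - (1 / (e + 1) : ℝ≥0) : ℝ) = (e - 1) / (e + 1) := by
    push_cast
    exact (sub_div ..).symm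
  have hE : 1 ≤ 1 + ((e : ℝ) - 1) / (e + 1) * r := le_add_of_nonneg_right
    (mul_nonneg (div_nonneg (sub_nonneg.mpr (by exact_mod_cast he)) (by positivity)) hr₀)
  set a := e / (e + 1)
  set b := 1 / (e + 1)
  set W : ι → FiniteMeasure Y := fun i => (e⁻¹ / 2) • q₀ + (e⁻¹ / 2) • q₁ + L i
  have hmassW (i : ι) : (W i).mass ≤ 1 := by
    rw [← hL i, add_comm (L i).mass, mass_add, ← add_halves e⁻¹]
    gcongr
    simpa only [add_halves] using mass_mix_le hq₀ hq₁ (e⁻¹ / 2) (e⁻¹ / 2)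
  have replace_by_clones := map_update_le_map_update_add hmass (fun i => (hν i).le) hmassW
    (hν i₀).le (hab ▸ mass_mix_le hq₀ hq₁ a b) (i₀ := i₀)
    (fun i => (hW i).2.mono (δ' := (1 + e⁻¹) * δ) (by rw [← mul_assoc, two_mul]; gcongr))
    (hP.mono (le_mul_of_one_le_left zero_le le_self_add))
  have restore_laws := map_update_le_map_update_add hmass hmassW (fun i => (hν i).le)
    ((add_comm b a).trans hab ▸ mass_mix_le hq₀ hq₁ b a) hQ.le (i₀ := i₀)
    (fun i => (hW i).1) (almostLE_of_le hQ' _)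
  have amplify := map_update_clone_mix_le Φ hΦ hmass hab (div_le_div_of_nonneg_right he zero_le)
    (inv_ne_zero he₀) (mass_smul_le hq₀ _) (mass_smul_le hq₁ _) (fun i => (hL i).le) hr₀ hr₂
    (by rwa [NNReal.coe_inv, inv_mul_eq_div]) hl i₀
  rw [hab_sub] at amplify
  rw [Function.update_eq_self, mul_left_comm] at replace_by_clones
  rw [mul_left_comm] at restore_laws
  exact le_of_perturbed_amplification (by exact_mod_cast he₁) hE (by positivity)
    (by exact_mod_cast replace_by_clones) amplify (by exact_mod_cast restore_laws)

end Amplification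

section ProductMeasure

variable {ι Y : Type*} [Fintype ι] [MeasurableSpace Y]

theorem prod_update_apply [DecidableEq ι] (ν : ι → FiniteMeasure Y) (i : ι) (μ : FiniteMeasure Y)
    (s : ι → Set Y) :
    ∏ j, (Function.update ν i μ j : Measure Y) (s j) =
      (μ : Measure Y) (s i) * ∏ j ∈ univ.erase i, (ν j : Measure Y) (s j) := by
  rw [← mul_prod_erase univ _ (mem_univ i), Function.update_self]
  congr 1
  exact prod_congr rfl fun j hj => by rw [Function.update_of_ne (ne_of_mem_erase hj)]

theorem pi_update_add [DecidableEq ι] (ν : ι → FiniteMeasure Y) (i : ι) (μ μ' : FiniteMeasure Y) :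
    Measure.pi (fun j => (Function.update ν i (μ + μ') j : Measure Y)) =
      Measure.pi (fun j => (Function.update ν i μ j : Measure Y)) +
        Measure.pi (fun j => (Function.update ν i μ' j : Measure Y)) :=
  Measure.pi_eq fun s _ => by
    simp only [Measure.add_apply, Measure.pi_pi, prod_update_apply, FiniteMeasure.toMeasure_add,
      add_mul]

theorem pi_update_smul [DecidableEq ι] (ν : ι → FiniteMeasure Y) (i : ι) (c : ℝ≥0)
    (μ : FiniteMeasure Y) :
    Measure.pi (fun j => (Function.update ν i (c • μ) j : Measure Y)) =
      c • Measure.pi (fun j => (Function.update ν i μ j : Measure Y)) :=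
  Measure.pi_eq fun s _ => by
    simp only [Measure.smul_apply, Measure.pi_pi, prod_update_apply, FiniteMeasure.toMeasure_smul,
      smul_mul_assoc]

theorem map_pi_comp_perm (μ : ι → Measure Y) [∀ i, SigmaFinite (μ i)] (σ : Equiv.Perm ι) :
    (Measure.pi μ).map (fun y i => y (σ i)) = Measure.pi (μ ∘ σ) :=
  (measurePreserving_piCongrLeft μ σ).symm.map_eq

end ProductMeasure

section Shuffle

variable {Y : Type*} [MeasurableSpace Y] {n : ℕ}

theorem measurable_comp_perm (σ : Equiv.Perm (Fin n)) :
    Measurable (fun (y : Fin n → Y) i => y (σ i)) := by fun_prop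

theorem shuffle_add (μ ν : Measure (Fin n → Y)) : shuffle (μ + ν) = shuffle μ + shuffle ν := by
  simp only [shuffle, Measure.map_add _ _ (measurable_comp_perm _), smul_add, sum_add_distrib]

theorem shuffle_smul (c : ℝ≥0) (μ : Measure (Fin n → Y)) : shuffle (c • μ) = c • shuffle μ := by
  simp only [shuffle, Measure.map_smul, smul_sum, smul_comm c]

theorem shuffle_univ (μ : Measure (Fin n → Y)) : shuffle μ Set.univ = μ Set.univ := by
  simp only [shuffle, Measure.coe_finsetSum, Finset.sum_apply, Measure.smul_apply, smul_eq_mul,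
    Measure.map_apply (measurable_comp_perm _) MeasurableSet.univ, Set.preimage_univ, sum_const,
    card_univ, Fintype.card_perm, Fintype.card_fin, nsmul_eq_mul]
  rw [← mul_assoc, ENNReal.mul_inv_cancel (by exact_mod_cast n.factorial_ne_zero)
    (ENNReal.natCast_ne_top _), one_mul]

theorem shuffle_map_perm (μ : Measure (Fin n → Y)) (τ : Equiv.Perm (Fin n)) :
    shuffle (μ.map (fun y i => y (τ i))) = shuffle μ := by
  simp only [shuffle, Measure.map_map (measurable_comp_perm _) (measurable_comp_perm _)]
  exact Equiv.sum_comp (Equiv.mulLeft τ)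
    fun σ => ((n.factorial : ENNReal))⁻¹ • μ.map (fun y i => y (σ i))

theorem shuffle_pi_apply_le (ν : Fin n → FiniteMeasure Y) (S : Set (Fin n → Y)) :
    shuffle (Measure.pi fun i => (ν i : Measure Y)) S ≤ (∏ i, (ν i).mass : ℝ≥0) := by
  refine (measure_mono (Set.subset_univ S)).trans_eq ?_
  simp only [shuffle_univ, Measure.pi_univ, ENNReal.ofNNReal_finsetProd, FiniteMeasure.ennreal_mass]

theorem shuffle_pi_apply_ne_top (ν : Fin n → FiniteMeasure Y) (S : Set (Fin n → Y)) :
    shuffle (Measure.pi fun i => (ν i : Measure Y)) S ≠ ⊤ :=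
  ne_top_of_le_ne_top ENNReal.coe_ne_top (shuffle_pi_apply_le ν S)

/-- The probability of the event `S` after shuffling independent outputs, as a multilinear
functional of their laws. -/
noncomputable def shuffledMass (S : Set (Fin n → Y)) :
    MultilinearMap ℝ≥0 (fun _ : Fin n => FiniteMeasure Y) ℝ≥0 where
  toFun ν := (shuffle (Measure.pi fun i => (ν i : Measure Y)) S).toNNReal
  map_update_add' := by
    intro _ ν i μ μ'
    simp only [pi_update_add, shuffle_add, Measure.add_apply,
      ENNReal.toNNReal_add (shuffle_pi_apply_ne_top _ S) (shuffle_pi_apply_ne_top _ S)]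
  map_update_smul' := by
    intro _ ν i c μ
    rw [pi_update_smul, shuffle_smul, Measure.smul_apply, ENNReal.smul_def, smul_eq_mul,
      ENNReal.toNNReal_mul, ENNReal.toNNReal_coe, smul_eq_mul]

theorem coe_shuffledMass (S : Set (Fin n → Y)) (ν : Fin n → FiniteMeasure Y) :
    (shuffledMass S ν : ENNReal) = shuffle (Measure.pi fun i => (ν i : Measure Y)) S :=
  ENNReal.coe_toNNReal (shuffle_pi_apply_ne_top ν S)

theorem shuffledMass_le (S : Set (Fin n → Y)) (ν : Fin n → FiniteMeasure Y) :
    shuffledMass S ν ≤ ∏ i, (ν i).mass := by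
  rw [← ENNReal.coe_le_coe, coe_shuffledMass]
  exact shuffle_pi_apply_le ν S

theorem shuffledMass_comp_perm (S : Set (Fin n → Y)) (ν : Fin n → FiniteMeasure Y)
    (σ : Equiv.Perm (Fin n)) : shuffledMass S (ν ∘ σ) = shuffledMass S ν := by
  rw [← ENNReal.coe_inj, coe_shuffledMass, coe_shuffledMass]
  rw [← shuffle_map_perm (Measure.pi fun i => (ν i : Measure Y)) σ, map_pi_comp_perm]
  rfl

end Shuffle

section DifferentialPrivacy

variable {X Y : Type*} [MeasurableSpace Y]

theorem dpBound_iff_almostLE {P Q : FiniteMeasure Y} {ε δ : ℝ} :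
    DPBound ε δ (P : Measure Y) Q ↔ AlmostLE δ.toNNReal P ((Real.exp ε).toNNReal • Q) := by
  simp only [DPBound, AlmostLE, ← FiniteMeasure.ennreal_coeFn_eq_coeFn_toMeasure,
    FiniteMeasure.smul_apply, smul_eq_mul, ENNReal.ofReal, ← ENNReal.coe_mul, ← ENNReal.coe_add,
    ENNReal.coe_le_coe]

theorem IsDP.mono {Z : Type*} [MeasurableSpace Z] {n : ℕ} {M : (Fin n → X) → Measure Z}
    {ε δ δ' : ℝ} (h : IsDP M ε δ) (hδ : δ ≤ δ') : IsDP M ε δ' :=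
  fun x x' hx S hS => (h x x' hx S hS).trans (by gcongr)

theorem isDP_clientView {R : X → Measure Y} [∀ x, IsProbabilityMeasure (R x)] {n : ℕ}
    {ε₀ δ₀ ε l r : ℝ} (hε₀ : 0 ≤ ε₀) (hδ₀ : 0 ≤ δ₀) (hR : IsLocallyDP R ε₀ δ₀)
    (hr₀ : 0 ≤ r) (hr₂ : r ≤ 2) (hr : r ^ 2 * (n / Real.exp ε₀) = 64 * l) (hl : Real.log 2 ≤ l)
    (hε : Real.exp ε = 1 + (Real.exp ε₀ - 1) / (Real.exp ε₀ + 1) * r) :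
    IsDP (fun x : Fin n → X => clientView R x) ε
      (Real.exp (-l) + (Real.exp ε + 1) * (Real.exp (-ε₀) / 2 + 1) * n * δ₀) := by
  rintro x x' ⟨i₀, hx⟩ S -
  let law (z : X) : FiniteMeasure Y := ⟨R z, inferInstance⟩
  have hlaw (z : X) : (law z).mass = 1 := by
    rw [← ENNReal.coe_inj, FiniteMeasure.ennreal_mass]
    exact measure_univ (μ := R z)
  have hldp (z z' : X) : AlmostLE δ₀.toNNReal (law z) ((Real.exp ε₀).toNNReal • law z') :=
    dpBound_iff_almostLE.mp (hR z z')
  have hview (z : Fin n → X) : clientView R z S = (shuffledMass S (law ∘ z) : ENNReal) :=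
    (coe_shuffledMass S (law ∘ z)).symm
  have hx' : Function.update (law ∘ x) i₀ (law (x' i₀)) = law ∘ x' :=
    Function.update_eq_iff.mpr ⟨rfl, fun j hj => congrArg law (hx j hj)⟩
  have hexp : ((Real.exp ε₀).toNNReal : ℝ) = Real.exp ε₀ :=
    Real.coe_toNNReal _ (Real.exp_nonneg _)
  have key := map_le_mul_map_update_add (shuffledMass_comp_perm S) (shuffledMass_le S)
    (Real.one_le_toNNReal.mpr (Real.one_le_exp hε₀)) (ν := law ∘ x) (fun i => hlaw (x i))
    (hlaw (x' i₀)) (hldp (x i₀) (x' i₀)) (fun j => hldp (x i₀) (x j))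
    (fun j => hldp (x' i₀) (x j)) hr₀ hr₂ (by rwa [hexp, Fintype.card_fin]) hl
  rw [hx', hexp, Real.coe_toNNReal _ hδ₀, Fintype.card_fin, ← Real.exp_neg, ← hε, add_assoc,
    ← mul_assoc _ (n : ℝ)] at key
  simp only [hview]
  rw [← ENNReal.ofReal_coe_nnreal, ← ENNReal.ofReal_coe_nnreal,
    ← ENNReal.ofReal_mul (by positivity), ← ENNReal.ofReal_add (by positivity) (by positivity)]
  exact ENNReal.ofReal_le_ofReal key

theorem isDP_clientView_of_log_two_le {R : X → Measure Y} [∀ x, IsProbabilityMeasure (R x)]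
    {n : ℕ} {ε₀ δ₀ ε l : ℝ} (hε₀ : 0 ≤ ε₀) (hδ₀ : 0 ≤ δ₀) (hR : IsLocallyDP R ε₀ δ₀)
    (hl : Real.log 2 ≤ l) (hln : 16 * l ≤ n / Real.exp ε₀)
    (hε : Real.exp ε = 1 + (Real.exp ε₀ - 1) / (Real.exp ε₀ + 1) *
      (8 * Real.sqrt (Real.exp ε₀ * l / n))) :
    IsDP (fun x : Fin n → X => clientView R x) ε
      (Real.exp (-l) + (Real.exp ε + 1) * (Real.exp (-ε₀) / 2 + 1) * n * δ₀) := by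
  have hl₀ : 0 < l := (Real.log_pos one_lt_two).trans_le hl
  have hn : 0 < n / Real.exp ε₀ := by linarith
  have hlog : Real.exp ε₀ * l / n = l / (n / Real.exp ε₀) := by rw [div_div_eq_mul_div, mul_comm]
  refine isDP_clientView hε₀ hδ₀ hR (by positivity) ?_ ?_ hl hε
  · have : Real.sqrt (Real.exp ε₀ * l / n) ≤ 1 / 4 :=
      Real.sqrt_le_iff.mpr ⟨by norm_num, by rw [hlog, div_le_iff₀ hn]; linarith⟩
    linarith
  · rw [mul_pow, Real.sq_sqrt (by positivity), hlog, mul_assoc, div_mul_cancel₀ _ hn.ne']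
    norm_num

end DifferentialPrivacy

end Safhire

theorem mainTheorem1 {X Y : Type*} [MeasurableSpace Y]
    (R : X → Measure Y) [∀ x, IsProbabilityMeasure (R x)]
    (n : ℕ) (hn : 1 ≤ n) (ε₀ δ₀ : ℝ) (hε₀ : 0 ≤ ε₀) (hδ₀ : 0 ≤ δ₀)
    (hR : Safhire.IsLocallyDP R ε₀ δ₀)
    (δ : ℝ) (hδ_pos : 0 < δ) (hδ_le : δ ≤ 1)
    (hn_large : ε₀ ≤ Real.log (n / (16 * Real.log (2 / δ)))) :
    ∃ ε : ℝ, 0 ≤ ε ∧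
      ε ≤ Real.log (1 + (Real.exp ε₀ - 1) / (Real.exp ε₀ + 1) *
        (8 * Real.sqrt (Real.exp ε₀ * Real.log (4 / δ)) / Real.sqrt n
          + 8 * Real.exp ε₀ / n)) ∧
      Safhire.IsDP (fun x : Fin n → X => Safhire.clientView R x) ε
        (δ + (Real.exp ε + 1) * (Real.exp (-ε₀) / 2 + 1) * n * δ₀) := by
  set l := Real.log (2 / δ)
  have hn₀ : (0 : ℝ) < n := by exact_mod_cast hn
  have hl : Real.log 2 ≤ l :=
    Real.log_le_log two_pos ((le_div_iff₀ hδ_pos).mpr (by linarith))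
  have hl₀ : 0 < l := (Real.log_pos one_lt_two).trans_le hl
  have hl_le : l ≤ Real.log (4 / δ) := Real.log_le_log (by positivity) (by gcongr; norm_num)
  have hexpl : Real.exp (-l) ≤ δ := by
    rw [Real.exp_neg, Real.exp_log (by positivity), inv_div]
    linarith
  have hln : 16 * l ≤ n / Real.exp ε₀ := by
    rwa [Real.le_log_iff_exp_le (by positivity), le_div_comm₀ (Real.exp_pos _) (by positivity)]
      at hn_large
  have hratio : 0 ≤ (Real.exp ε₀ - 1) / (Real.exp ε₀ + 1) :=
    div_nonneg (sub_nonneg.mpr (Real.one_le_exp hε₀)) (by positivity)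
  refine ⟨Real.log (1 + (Real.exp ε₀ - 1) / (Real.exp ε₀ + 1) *
      (8 * Real.sqrt (Real.exp ε₀ * l / n))),
    Real.log_nonneg (le_add_of_nonneg_right (by positivity)), ?_,
    (Safhire.isDP_clientView_of_log_two_le hε₀ hδ₀ hR hl hln
      (Real.exp_log (by positivity))).mono (by gcongr)⟩
  rw [mul_div_assoc 8 (Real.sqrt _), ← Real.sqrt_div' _ hn₀.le]
  gcongr
  refine le_add_of_le_of_nonneg ?_ (by positivity)
  gcongr
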